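/- Let $\mathcal L$ be a finite relational signature all of whose symbols have arity $\ge 1$, and let $X$ be a recursive $\mathcal L$-structure, i.e. a structure with domain $\omega=\{0,1,2,\dots\}$ all of whose relations are recursive. Suppose that $X$ is homogeneous (every isomorphism between finite substructures of $X$ extends to an automorphism of $X$). Let $\mathrm{Age}(X)$ be the class of finite $\mathcal L$-structures that embed into $X$, and suppose that it is dense: whenever $A,B\in\mathrm{Age}(X)$ and $i:A\to B$ is an embedding, there are $C\in\mathrm{Age}(X)$ and embeddings $f_1,f_2:B\to C$ such that $f_1 i=f_2 i$ and $\mathrm{Im} f_1\cap\mathrm{Im} f_2=\mathrm{Im}\, f_1 i$. Let $\beta\in\mathrm{Age}(X)$ be non-empty, let $[X,\beta]$ be the set of copies of $\beta$ in $X$ (images of embeddings $\beta\to X$), and let $\beta_0,\beta_1,\beta_2,\dots$ be a recursive enumeration, without repetition, of $[X,\beta]$. For an infinite binary string $\alpha=\alpha_0\alpha_1\alpha_2\cdots$ let $\chi_\alpha:[X,\beta]\to\{0,1\}$ be the colouring with $\chi_\alpha(\beta_i)=\alpha_i$ for all $i$. A prefix algorithm is a partial recursive function $\{0,1\}^*\to\{0,1\}^*$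 with prefix-free domain. Fix a universal one, $U$ (for every prefix algorithm $f$ there is a constant $c$ such that each word $f(p)$ equals $U(q)$ for some $q$ of length at most $|p|+c$), and let $H(s)$ be the length of a shortest $p$ with $U(p)=s$. An infinite binary string $\varepsilon$ is a KC-string if there is an $m$ such that $H(\varepsilon_0\cdots\varepsilon_{n-1})\ge n-m$ for all $n$. Then for every KC-string $\varepsilon$ there is an embedding $\nu:X\to X$, recursive relative to $\varepsilon$, such that $\chi_\varepsilon(\beta')=1$ for every copy $\beta'$ of $\beta$ contained in $\nu(X)$. -/

import Mathlib

open FirstOrder CategoryTheory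

universe u v w

namespace KCHom

/-! ### Prefix algorithms, Kolmogorov complexity, KC-strings -/

/-- A prefix algorithm: a partial recursive function on binary words whose domain is prefix-free. -/
def IsPrefixAlgorithm (f : List Bool →. List Bool) : Prop :=
  Partrec f ∧ ∀ p q : List Bool, (f p).Dom → (f q).Dom → p <+: q → p = q

/-- A universal prefix algorithm: a prefix algorithm which, up to an additive constant in the
length of programs, describes words as economically as any other prefix algorithm does. -/
def IsUniversalPrefixAlgorithm (U : List Bool →. List Bool) : Prop :=
  IsPrefixAlgorithm U ∧
    ∀ f : List Bool →. List Bool, IsPrefixAlgorithm f →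
      ∃ c : ℕ, ∀ p s : List Bool, s ∈ f p → ∃ q : List Bool, s ∈ U q ∧ q.length ≤ p.length + c

/-- The Kolmogorov complexity `H(s)`: the length of a shortest `U`-program for `s`
(and `⊤` if there is no program at all). -/
noncomputable def complexity (U : List Bool →. List Bool) (s : List Bool) : ℕ∞ :=
  ⨅ p ∈ {p : List Bool | s ∈ U p}, (p.length : ℕ∞)

/-- The word consisting of the first `n` bits of `α`. -/
def initialWord (α : ℕ → Bool) (n : ℕ) : List Bool :=
  (List.range n).map α

/-- `ε` is a Kolmogorov-Chaitin string: `∃ m, ∀ n, H(ε₀ … ε_{n-1}) ≥ n - m`. -/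
def IsKCString (U : List Bool →. List Bool) (ε : ℕ → Bool) : Prop :=
  ∃ m : ℕ, ∀ n : ℕ, (n : ℕ∞) ≤ complexity U (initialWord ε n) + m

/-! ### Structures -/

/-- A relational structure with domain `ℕ` is recursive if each of its relations is recursive. -/
def IsRecursiveStructure (L : FirstOrder.Language.{u, v}) [L.Structure ℕ] : Prop :=
  ∀ (n : ℕ) (R : L.Relations n),
    ComputablePred fun x : Fin n → ℕ => FirstOrder.Language.Structure.RelMap R x

/-- The age of `M` is dense: for every embedding `i : A → B` between members of the age there are
a member `C` of the age and embeddings `f₁, f₂ : B → C` with `f₁ i = f₂ i` whose images meet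
exactly in the image of `f₁ i`. -/
def HasDenseAge (L : FirstOrder.Language.{u, v}) (M : Type w) [L.Structure M] : Prop :=
  ∀ A ∈ L.age M, ∀ B ∈ L.age M, ∀ i : A ↪[L] B,
    ∃ C ∈ L.age M, ∃ f₁ f₂ : B ↪[L] C,
      f₁.comp i = f₂.comp i ∧
        Set.range f₁ ∩ Set.range f₂ = Set.range (f₁.comp i)

/-- `[X, β]`, the set of copies of `β` in a structure `X` with domain `ℕ`, a copy being the image
of an embedding of `β` into `X`. -/
def copies (L : FirstOrder.Language.{u, v}) [L.Structure ℕ] (β : Type w) [L.Structure β] :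
    Set (Finset ℕ) :=
  {s | ∃ f : β ↪[L] ℕ, Set.range f = (s : Set ℕ)}

/-- An enumeration (without repetition) of a set of finite subsets of `ℕ` is recursive if a list
of the elements of the `i`-th set can be computed from `i`. -/
def IsRecursiveEnumeration {S : Set (Finset ℕ)} (b : ℕ ≃ S) : Prop :=
  ∃ l : ℕ → List ℕ, Computable l ∧ ∀ i : ℕ, (l i).toFinset = (b i : Finset ℕ)

/-- The colouring `χ_α` of `[X, β]` induced by an infinite binary string `α`: the `i`-th copy
in the enumeration `b` is given the colour `α i`. -/
def colouring {S : Set (Finset ℕ)} (b : ℕ ≃ S) (α : ℕ → Bool) : S → Bool :=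
  fun c => α (b.symm c)

/-- A function `g : ℕ → ℕ` is recursive relative to the infinite binary string `ε`. -/
def RecursiveRelativeTo (ε : ℕ → Bool) (g : ℕ → ℕ) : Prop :=
  ComputableIn {((fun n => (ε n).toNat : ℕ → ℕ) : ℕ →. ℕ)} g

end KCHom

/-! The embedding is built one point at a time. Suppose a finite partial embedding of an initial
segment has values listed by `σ`. Homogeneity extends it to an automorphism, and density makes the
orbit over `σ` of the next value infinite, so infinitely many `y` can come next
(`infinite_sameType_append`). Choosing `y` creates only the copies of `β` that contain `y` and lie
in `σ ∪ {y}`. Their number is bounded independently of `y`, and different `y` give disjoint sets of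
indices. It remains to find one `y` whose new indices all carry the bit 1.

A KC-string cannot fail at every `y` (`exists_of_isKCString`). If each `y` needs at most `k` bits,
then `2 ^ k * (2 * e)` of them are missed by at most a fraction `2 ^ (-2e)` of the words of a
suitable length `M`. A word in this small decidable set is described by `e` in unary and its rank in
`M - 2e` bits, about `e` bits fewer than its length; this is impossible for large `e`
(`not_isKCString_of_small`).

Hence the search for a good `y` along `ε` always stops, and iterating it is recursive in `ε`. A copy
in the final image is monochromatic because it was new at the stage that added its last point; such
a point exists since `β` is non-empty. -/

namespace ComputablePred

/-! ### Closure properties of decidable predicates, and unbounded search. -/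

variable {α β γ : Type*} [Primcodable α] [Primcodable β] [Primcodable γ]

theorem comp {p : β → Prop} (hp : ComputablePred p) {f : α → β} (hf : Computable f) :
    ComputablePred fun a => p (f a) := by
  classical
  exact (hp.decide.comp hf).computablePred

protected theorem and {p q : α → Prop} (hp : ComputablePred p) (hq : ComputablePred q) :
    ComputablePred fun a => p a ∧ q a := by
  classical
  exact ((Primrec.and.to_comp.comp hp.decide hq.decide).of_eq fun a => by simp).computablePred

protected theorem or {p q : α → Prop} (hp : ComputablePred p) (hq : ComputablePred q) :
    ComputablePred fun a => p a ∨ q a := by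
  classical
  exact ((Primrec.or.to_comp.comp hp.decide hq.decide).of_eq fun a => by simp).computablePred

protected theorem imp {p q : α → Prop} (hp : ComputablePred p) (hq : ComputablePred q) :
    ComputablePred fun a => p a → q a :=
  (hp.not.or hq).of_eq fun _ => imp_iff_not_or.symm

protected theorem iff {p q : α → Prop} (hp : ComputablePred p) (hq : ComputablePred q) :
    ComputablePred fun a => p a ↔ q a :=
  ((hp.imp hq).and (hq.imp hp)).of_eq fun _ => iff_iff_implies_and_implies.symm

protected theorem eq {f g : α → β} (hf : Computable f) (hg : Computable g) :
    ComputablePred fun a => f a = g a := by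
  classical
  exact (PrimrecPred.computablePred (Primrec.eq (α := β))).comp (hf.pair hg)

protected theorem le {f g : α → ℕ} (hf : Computable f) (hg : Computable g) :
    ComputablePred fun a => f a ≤ g a :=
  (PrimrecPred.computablePred Primrec.nat_le).comp (hf.pair hg)

protected theorem const (p : Prop) : ComputablePred fun _ : α => p := by
  classical
  exact (Computable.const (decide p)).computablePred

theorem exists_computable₂_bool {p : α → β → Prop}
    (hp : ComputablePred fun x : α × β => p x.1 x.2) :
    ∃ d : α → β → Bool, Computable₂ d ∧ ∀ a b, d a b = true ↔ p a b := by
  classical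
  exact ⟨fun a b => decide (p a b), hp.decide, fun a b => by simp⟩

theorem forall_lt {f : α → ℕ} (hf : Computable f) {p : α → ℕ → Prop}
    (hp : ComputablePred fun x : α × ℕ => p x.1 x.2) :
    ComputablePred fun a => ∀ i < f a, p a i := by
  classical
  obtain ⟨d, hd, hdp⟩ := exists_computable₂_bool hp
  have hstep : Computable₂ fun (a : α) (x : ℕ × Bool) => x.2 && d a x.1 :=
    Computable₂.mk (Primrec.and.to_comp.comp (Computable.snd.comp Computable.snd)
      (hd.comp Computable.fst (Computable.fst.comp Computable.snd)))
  have h : Computable fun a => Nat.rec (motive := fun _ => Bool) true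
      (fun i b => b && d a i) (f a) :=
    Computable.nat_rec hf (Computable.const true) hstep
  refine (h.of_eq (g := fun a => decide (∀ i < f a, p a i)) fun a => ?_).computablePred
  induction f a with
  | zero => simp
  | succ n ih =>
    simp only [ih, Nat.forall_lt_succ_right, Bool.decide_and]
    congr 1
    rw [Bool.eq_iff_iff, hdp, decide_eq_true_iff]

theorem exists_lt {f : α → ℕ} (hf : Computable f) {p : α → ℕ → Prop}
    (hp : ComputablePred fun x : α × ℕ => p x.1 x.2) :
    ComputablePred fun a => ∃ i < f a, p a i :=
  (forall_lt hf (p := fun a i => ¬p a i) hp.not).not.of_eq fun a => by simp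

theorem forall_mem_list {f : α → List β} (hf : Computable f) {p : α → β → Prop}
    (hp : ComputablePred fun x : α × β => p x.1 x.2) :
    ComputablePred fun a => ∀ b ∈ f a, p a b := by
  classical
  obtain ⟨d, hd, hdp⟩ := exists_computable₂_bool hp
  have h : ComputablePred fun x : α × ℕ => ∀ b, (f x.1)[x.2]? = some b → p x.1 b := by
    have hget : Computable fun x : α × ℕ => (f x.1)[x.2]? :=
      Computable.list_getElem?.comp (hf.comp Computable.fst) Computable.snd
    have hdec : Computable₂ fun (x : α × ℕ) (b : β) => d x.1 b :=
      Computable₂.mk (hd.comp (Computable.fst.comp Computable.fst) Computable.snd)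
    have := Computable.option_casesOn hget (Computable.const true) hdec
    refine (this.of_eq fun x => ?_).computablePred
    rcases (f x.1)[x.2]? with _ | b <;> simp [← hdp]
  refine (forall_lt (p := fun a i => ∀ b, (f a)[i]? = some b → p a b) (Computable.list_length.comp hf) h).of_eq fun a => ?_
  constructor
  · intro H b hb
    obtain ⟨i, hi, rfl⟩ := List.mem_iff_getElem.1 hb
    exact H i hi _ (List.getElem?_eq_getElem hi)
  · intro H i _ b hb
    exact H b (List.mem_of_getElem? hb)

theorem mem_list {f : α → β} {l : α → List β} (hf : Computable f) (hl : Computable l) :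
    ComputablePred fun a => f a ∈ l a :=
  (forall_mem_list hl (p := fun a b => f a ≠ b)
    (ComputablePred.eq (hf.comp Computable.fst) Computable.snd).not).not.of_eq
    fun a => by simp

theorem forall_finite {ι : Type*} [Finite ι] {p : ι → α → Prop}
    (hp : ∀ i, ComputablePred (p i)) : ComputablePred fun a => ∀ i, p i a := by
  classical
  cases nonempty_fintype ι
  suffices ∀ s : Finset ι, ComputablePred fun a => ∀ i ∈ s, p i a from
    (this Finset.univ).of_eq fun a => by simp
  intro s
  induction s using Finset.induction_on with
  | empty => exact (ComputablePred.const True).of_eq fun a => by simp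
  | insert i s _ ih => exact ((hp i).and ih).of_eq fun a => by simp

theorem nodup {f : α → List β} (hf : Computable f) : ComputablePred fun a => (f a).Nodup := by
  have h : ComputablePred fun a => ∀ i < (f a).length, ∀ j < i, (f a)[j]? ≠ (f a)[i]? :=
    forall_lt (Computable.list_length.comp hf) <|
      forall_lt Computable.snd <| ComputablePred.not <| ComputablePred.eq
        (Computable.list_getElem?.comp (hf.comp (Computable.fst.comp Computable.fst))
          Computable.snd)
        (Computable.list_getElem?.comp (hf.comp (Computable.fst.comp Computable.fst))
          (Computable.snd.comp Computable.fst))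
  refine h.of_eq fun a => ?_
  rw [List.nodup_iff_getElem?_ne_getElem?]
  exact ⟨fun H i j hij hj => H j hj i hij, fun H i hi j hj => H j i hj hi⟩

/-- A decidable relation can be tested on the codes 0, 1, 2, … in turn until a witness appears. -/
theorem exists_partrec_search {R : α → β → Prop}
    (hR : ComputablePred fun x : α × β => R x.1 x.2) :
    ∃ f : α →. β, Partrec f ∧ (∀ a, ∀ b ∈ f a, R a b) ∧ ∀ a, (∃ b, R a b) → (f a).Dom := by
  obtain ⟨d, hd, hdR⟩ := exists_computable₂_bool hR
  let g : α → ℕ → Option β := fun a n =>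
    (Encodable.decode n : Option β).bind fun b => bif d a b then some b else none
  have hdec : Computable fun x : α × ℕ => (Encodable.decode x.2 : Option β) :=
    Computable.decode.comp Computable.snd
  have hstep : Computable₂ fun (x : α × ℕ) (b : β) =>
      bif d x.1 b then some b else none :=
    Computable₂.mk (Computable.cond
      (hd.comp (Computable.fst.comp Computable.fst) Computable.snd)
      (Computable.option_some.comp Computable.snd) (Computable.const none))
  have hg : Computable₂ g := Computable₂.mk (Computable.option_bind hdec hstep)
  have hmem : ∀ a n b, b ∈ g a n ↔ Encodable.decode n = some b ∧ R a b := by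
    intro a n b
    simp only [g, Option.mem_def, Option.bind_eq_some_iff]
    constructor
    · rintro ⟨c, hc, h⟩
      cases hdc : d a c <;> simp only [hdc, cond_false, cond_true, reduceCtorEq] at h
      cases h
      exact ⟨hc, (hdR a _).1 hdc⟩
    · rintro ⟨h, h'⟩
      exact ⟨b, h, by rw [(hdR a b).2 h', cond_true]⟩
  refine ⟨fun a => Nat.rfindOpt (g a), Partrec.rfindOpt hg, fun a b hb => ?_, fun a ⟨b, hb⟩ => ?_⟩
  · obtain ⟨n, hn⟩ := Nat.rfindOpt_spec hb
    exact ((hmem _ _ _).1 hn).2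
  · exact Nat.rfindOpt_dom.2 ⟨Encodable.encode b, b, (hmem _ _ _).2 ⟨by simp, hb⟩⟩

theorem exists_computable_choice {R : α → β → Prop}
    (hR : ComputablePred fun x : α × β => R x.1 x.2) (h : ∀ a, ∃ b, R a b) :
    ∃ f : α → β, Computable f ∧ ∀ a, R a (f a) := by
  obtain ⟨f, hf, hfR, hdom⟩ := exists_partrec_search hR
  exact ⟨fun a => (f a).get (hdom a (h a)), hf.of_eq_tot fun a => Part.get_mem _,
    fun a => hfR a _ (Part.get_mem _)⟩

end ComputablePred

theorem Computable.nat_count {α : Type*} [Primcodable α] {p : α → ℕ → Prop}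
    [∀ a, DecidablePred (p a)] (hp : ComputablePred fun x : α × ℕ => p x.1 x.2)
    {f : α → ℕ} (hf : Computable f) : Computable fun a => Nat.count (p a) (f a) := by
  have hd : Computable fun x : α × ℕ => decide (p x.1 x.2) := hp.decide
  have hstep : Computable₂ fun (a : α) (x : ℕ × ℕ) =>
      x.2 + bif decide (p a x.1) then 1 else 0 :=
    Computable₂.mk (Primrec.nat_add.to_comp.comp (Computable.snd.comp Computable.snd)
      (Computable.cond (hd.comp (Computable.fst.pair (Computable.fst.comp Computable.snd)))
        (Computable.const 1) (Computable.const 0)))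
  have h : Computable fun a => Nat.rec (motive := fun _ => ℕ) 0
      (fun i n => n + bif decide (p a i) then 1 else 0) (f a) :=
    Computable.nat_rec hf (Computable.const 0) hstep
  refine h.of_eq fun a => ?_
  induction f a with
  | zero => simp
  | succ n ih => rw [Nat.count_succ, ← ih]; by_cases h : p a n <;> simp [h]

/-! ### Compression of words by their rank in a small decidable set. -/

namespace KCHom

theorem length_initialWord (α : ℕ → Bool) (n : ℕ) : (initialWord α n).length = n := by
  simp [initialWord]

theorem getElem?_initialWord (α : ℕ → Bool) (n i : ℕ) :
    (initialWord α n)[i]? = if i < n then some (α i) else none := by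
  split_ifs with h
  · simp [initialWord, h]
  · simpa [initialWord] using h

/-- The rank of the word `w`, in the standard numbering of words, among the words satisfying `P`. -/
noncomputable def wordRank (P : List Bool → Prop) (w : List Bool) : ℕ :=
  open scoped Classical in
  Nat.count (fun x => x ∈ Encodable.encode '' {w | P w}) (Encodable.encode w)

theorem wordRank_injOn {P : List Bool → Prop} {w w' : List Bool} (hw : P w) (hw' : P w')
    (h : wordRank P w = wordRank P w') : w = w' := by
  classical
  exact Encodable.encode_injective (Nat.count_injective ⟨w, hw, rfl⟩ ⟨w', hw', rfl⟩ h)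

theorem ncard_eq_card_toFinset_image {P : List Bool → Prop} (hP : {w | P w}.Finite) :
    {w | P w}.ncard = (hP.image Encodable.encode).toFinset.card := by
  rw [← Set.ncard_eq_toFinset_card _ (hP.image _),
    Set.ncard_image_of_injective _ Encodable.encode_injective]

theorem wordRank_lt_ncard {P : List Bool → Prop} (hP : {w | P w}.Finite) {w : List Bool}
    (hw : P w) : wordRank P w < {w | P w}.ncard := by
  classical
  rw [ncard_eq_card_toFinset_image hP]
  exact Nat.count_lt_card (p := fun x => x ∈ Encodable.encode '' {w | P w})
    (hP.image Encodable.encode) ⟨w, hw, rfl⟩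

theorem exists_wordRank_eq {P : List Bool → Prop} (hP : {w | P w}.Finite) {r : ℕ}
    (hr : r < {w | P w}.ncard) : ∃ w, P w ∧ wordRank P w = r := by
  classical
  rw [ncard_eq_card_toFinset_image hP] at hr
  obtain ⟨w, hw, hwr⟩ := Nat.nth_mem_of_lt_card (p := fun x => x ∈ Encodable.encode '' {w | P w})
    (hP.image Encodable.encode) hr
  refine ⟨w, hw, ?_⟩
  rw [wordRank, hwr]
  exact Nat.count_nth_of_lt_card_finite (p := fun x => x ∈ Encodable.encode '' {w | P w})
    (hP.image Encodable.encode) hr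

theorem computable_wordRank {α : Type*} [Primcodable α] {P : α → List Bool → Prop}
    (hP : ComputablePred fun x : α × List Bool => P x.1 x.2) {f : α → List Bool}
    (hf : Computable f) : Computable fun a => wordRank (P a) (f a) := by
  classical
  refine Computable.nat_count (p := fun a x => x ∈ Encodable.encode '' {w | P a w}) ?_
    (Computable.encode.comp hf)
  -- The image under `encode` is decided by decoding and re-encoding, so no search is needed.
  have h : ComputablePred fun x : α × ℕ =>
      ∀ w ∈ (Encodable.decode x.2 : Option (List Bool)).toList,
        ¬ (Encodable.encode w = x.2 ∧ P x.1 w) :=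
    .forall_mem_list
      (p := fun (x : α × ℕ) (w : List Bool) => ¬ (Encodable.encode w = x.2 ∧ P x.1 w))
      (Primrec.optionToList.to_comp.comp (Computable.decode.comp .snd))
      (.not (.and (.eq (Computable.encode.comp .snd) (Computable.snd.comp .fst))
        (hP.comp ((Computable.fst.comp .fst).pair .snd))))
  refine h.not.of_eq fun ⟨a, x⟩ => ?_
  simp only [Set.mem_image, Set.mem_ofPred_eq]
  constructor
  · intro h
    push Not at h
    obtain ⟨w, -, hw, hP⟩ := h
    exact ⟨w, hP, hw⟩
  · rintro ⟨w, hP, rfl⟩ h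
    exact h w (by simp) ⟨rfl, hP⟩

theorem finite_length_eq (n : ℕ) : {w : List Bool | w.length = n}.Finite :=
  List.finite_length_eq Bool n

theorem ncard_length_eq (n : ℕ) : {w : List Bool | w.length = n}.ncard = 2 ^ n := by
  have : Nat.card (List.Vector Bool n) = 2 ^ n := by
    rw [Nat.card_eq_fintype_card, card_vector, Fintype.card_bool]
  rw [← this]
  rfl

theorem computable_unary :
    Computable fun n : ℕ => (List.range n).map fun _ => true :=
  (Primrec.list_map Primrec.list_range (Primrec.const true).to₂).to_comp

/-- The first `false` ends the unary block, so the parameter can be read off any extension; this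
makes the programs self-delimiting. -/
theorem unary_append_injective {e e' : ℕ} {v v' : List Bool}
    (h : ((List.range e).map fun _ => true) ++ false :: v <+:
      ((List.range e').map fun _ => true) ++ false :: v') : e = e' ∧ v <+: v' := by
  induction e generalizing e' with
  | zero =>
    cases e' with
    | zero => simpa using h
    | succ e' => simp [List.replicate_succ] at h
  | succ e ih =>
    cases e' with
    | zero => simp [List.replicate_succ] at h
    | succ e' =>
      have := @ih e' (by simpa [List.replicate_succ] using h)
      exact ⟨by rw [this.1], this.2⟩

/-- A string whose initial words lie in uniformly recursive, effectively small sets of words is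
not a KC-string. -/
theorem not_isKCString_of_small {U : List Bool →. List Bool} (hU : IsUniversalPrefixAlgorithm U)
    {ε : ℕ → Bool} {Q : ℕ → List Bool → Prop}
    (hQ : ComputablePred fun x : ℕ × List Bool => Q x.1 x.2) {M : ℕ → ℕ} (hM : Computable M)
    (hle : ∀ e, 2 * e ≤ M e) (hlen : ∀ e w, Q e w → w.length = M e)
    (hcard : ∀ e, {w | Q e w}.ncard ≤ 2 ^ (M e - 2 * e))
    (hε : ∀ e, Q e (initialWord ε (M e))) : ¬ IsKCString U ε := by
  classical
  -- The program for a word in `Q e`: the parameter in unary, then a word of length `M e - 2 * e`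
  -- whose rank is that of the described word. Its length is `M e - e + 1`.
  let code : ℕ → List Bool → List Bool := fun e v =>
    ((List.range e).map fun _ => true) ++ false :: v
  let R : List Bool → ℕ × List Bool × List Bool → Prop := fun p x =>
    p = code x.1 x.2.1 ∧ x.2.1.length = M x.1 - 2 * x.1 ∧ Q x.1 x.2.2 ∧
      wordRank (Q x.1) x.2.2 = wordRank (fun w => w.length = M x.1 - 2 * x.1) x.2.1
  have hsub : Computable fun e => M e - 2 * e :=
    Primrec.nat_sub.to_comp.comp hM
      (Primrec.nat_mul.to_comp.comp (Computable.const 2) Computable.id)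
  have hlenP : ComputablePred fun x : ℕ × List Bool => x.2.length = M x.1 - 2 * x.1 :=
    .eq (Computable.list_length.comp .snd) (hsub.comp .fst)
  have hR : ComputablePred fun x : List Bool × (ℕ × List Bool × List Bool) => R x.1 x.2 := by
    have he : Computable fun x : List Bool × (ℕ × List Bool × List Bool) => x.2.1 :=
      Computable.fst.comp .snd
    have hv : Computable fun x : List Bool × (ℕ × List Bool × List Bool) => x.2.2.1 :=
      Computable.fst.comp (Computable.snd.comp .snd)
    have hw : Computable fun x : List Bool × (ℕ × List Bool × List Bool) => x.2.2.2 :=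
      Computable.snd.comp (Computable.snd.comp .snd)
    refine .and (.eq .fst ?_) (.and ?_ (.and ?_ (.eq ?_ ?_)))
    · exact Computable.list_append.comp (computable_unary.comp he)
        (Computable.list_cons.comp (Computable.const false) hv)
    · exact hlenP.comp (he.pair hv)
    · exact hQ.comp (he.pair hw)
    · exact computable_wordRank
        (P := fun (x : List Bool × (ℕ × List Bool × List Bool)) w => Q x.2.1 w)
        (hQ.comp ((he.comp .fst).pair .snd)) hw
    · exact computable_wordRank
        (P := fun (x : List Bool × (ℕ × List Bool × List Bool)) w =>
          w.length = M x.2.1 - 2 * x.2.1)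
        (hlenP.comp ((he.comp .fst).pair .snd)) hv
  obtain ⟨g, hg, hgR, hgdom⟩ := hR.exists_partrec_search
  have hf : IsPrefixAlgorithm fun p => (g p).map fun x => x.2.2 := by
    refine ⟨hg.map (Computable.snd.comp (Computable.snd.comp .snd)).to₂, fun p q hp hq hpq => ?_⟩
    obtain ⟨h, h1, -⟩ := hgR p _ (Part.get_mem (o := g p) hp)
    obtain ⟨h', h2, -⟩ := hgR q _ (Part.get_mem (o := g q) hq)
    generalize (g p).get hp = x at h h1
    generalize (g q).get hq = y at h' h2
    have he := (unary_append_injective (h ▸ h' ▸ hpq)).1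
    refine hpq.eq_of_length ?_
    simp [h, h', code, h1, h2, he]
  obtain ⟨c, hc⟩ := hU.2 _ hf
  rintro ⟨m, hm⟩
  -- The program bounds the complexity by `M e - e + 1 + c`, whereas a KC-string needs at least `M e
  -- - m`; this is the least `e` that gives a contradiction.
  let e := c + m + 2
  let s := initialWord ε (M e)
  have hfin : ∀ e, {w | Q e w}.Finite := fun e =>
    (finite_length_eq (M e)).subset fun w hw => hlen e w hw
  obtain ⟨v, hv, hvr⟩ := exists_wordRank_eq (finite_length_eq (M e - 2 * e))
    (((wordRank_lt_ncard (hfin e) (hε e)).trans_le (hcard e)).trans_eq (ncard_length_eq _).symm)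
  have hex : R (code e v) (e, v, s) := ⟨rfl, hv, hε e, hvr.symm⟩
  have hmem : s ∈ (g (code e v)).map fun x => x.2.2 := by
    have hd := hgdom _ ⟨_, hex⟩
    refine (Part.mem_map_iff _).2 ⟨_, Part.get_mem hd, ?_⟩
    -- Whatever triple the search returns, the program determines its `e` and `v`, and the rank then
    -- determines the word.
    obtain ⟨h, -, hq, hr⟩ := hgR _ _ (Part.get_mem hd)
    generalize (g (code e v)).get hd = x at h hq hr
    obtain ⟨e', v', w⟩ := x
    dsimp only at h hq hr
    obtain ⟨rfl, -⟩ := unary_append_injective (h ▸ List.prefix_rfl : code e v <+: code e' v')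
    have : v = v' := by simpa [code] using h
    subst this
    exact wordRank_injOn hq (hε e) (hr.trans hvr)
  obtain ⟨q, hq, hql⟩ := hc _ _ hmem
  have h1 : complexity U s ≤ q.length := iInf₂_le q hq
  have h2 := (hm (M e)).trans (add_le_add_left h1 _)
  have h3 : M e ≤ q.length + m := by exact_mod_cast h2
  have h4 : (code e v).length = e + (M e - 2 * e + 1) := by simp [code, hv]
  have := hle e
  omega

end KCHom

/-! ### Counting the words that miss many disjoint sets, and its consequence for KC-strings. -/

namespace KCHom

/-- Avoiding many disjoint small sets is rare. -/
theorem card_filter_forall_not_subset {ι κ : Type*} [DecidableEq ι] [DecidableEq κ] (k : ℕ)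
    (S : κ → Finset ι) (I : Finset ι) (Y : Finset κ) (hdisj : (Y : Set κ).PairwiseDisjoint S)
    (hk : ∀ y ∈ Y, (S y).card ≤ k) (hI : ∀ y ∈ Y, S y ⊆ I) :
    (I.powerset.filter fun s => ∀ y ∈ Y, ¬ S y ⊆ s).card * (2 ^ k) ^ Y.card ≤
      (2 ^ k - 1) ^ Y.card * 2 ^ I.card := by
  induction Y using Finset.induction_on with
  | empty => simp
  | insert z Y hz ih =>
    have ih := ih (hdisj.subset (by simp)) (fun y hy => hk y (Finset.mem_insert_of_mem hy))
      (fun y hy => hI y (Finset.mem_insert_of_mem hy))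
    set A := I.powerset.filter fun s => ∀ y ∈ Y, ¬ S y ⊆ s with hA
    have hA' : (I.powerset.filter fun s => ∀ y ∈ insert z Y, ¬ S y ⊆ s) =
        A.filter fun s => ¬ S z ⊆ s := by
      ext s
      simp only [hA, Finset.mem_filter, Finset.mem_insert, forall_eq_or_imp]
      tauto
    have hsplit := Finset.card_filter_add_card_filter_not (s := A) fun s => S z ⊆ s
    -- Adding `S z` to a member of `A` keeps it in `A`, by disjointness, and the trace on `S z`
    -- recovers the original. So at least a fraction `2 ^ (-k)` of `A` contains `S z`.
    have hbound : A.card ≤ (A.filter fun s => S z ⊆ s).card * 2 ^ k := by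
      calc A.card ≤ ((A.filter fun s => S z ⊆ s) ×ˢ (S z).powerset).card := by
            refine Finset.card_le_card_of_injOn (fun s => (s ∪ S z, s ∩ S z)) ?_ ?_
            · intro s hs
              simp only [hA, Finset.coe_filter, Set.mem_ofPred_eq, Finset.mem_powerset] at hs
              simp only [Finset.coe_product, Set.mem_prod, Finset.mem_coe, Finset.mem_filter, hA,
                Finset.mem_powerset, Finset.union_subset_iff, Finset.inter_subset_right,
                Finset.subset_union_right, and_true]
              refine ⟨⟨hs.1, hI z (Finset.mem_insert_self _ _)⟩, fun y hy hsub => hs.2 y hy ?_⟩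
              have hd : Disjoint (S y) (S z) := hdisj (by simp [hy]) (by simp)
                (by rintro rfl; exact hz hy)
              exact hd.left_le_of_le_sup_right hsub
            · intro s _ t _ h
              simp only [Prod.mk.injEq] at h
              ext i
              have h1 := Finset.ext_iff.1 h.1 i
              have h2 := Finset.ext_iff.1 h.2 i
              simp only [Finset.mem_union, Finset.mem_inter] at h1 h2
              tauto
        _ ≤ _ := by
            rw [Finset.card_product, Finset.card_powerset]
            exact Nat.mul_le_mul_left _ (Nat.pow_le_pow_right (by norm_num)
              (hk z (Finset.mem_insert_self _ _)))
    rw [hA', Finset.card_insert_of_notMem hz, pow_succ, pow_succ]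
    obtain ⟨K, hK⟩ : ∃ K, 2 ^ k = K + 1 := ⟨2 ^ k - 1, by have := Nat.one_le_two_pow (n := k); omega⟩
    rw [hK] at ih hbound ⊢
    simp only [Nat.add_sub_cancel] at ih ⊢
    have hstep : (A.filter fun s => ¬ S z ⊆ s).card * (K + 1) ≤ K * A.card := by
      nlinarith
    calc _ = ((A.filter fun s => ¬ S z ⊆ s).card * (K + 1)) * (K + 1) ^ Y.card := by ring
      _ ≤ (K * A.card) * (K + 1) ^ Y.card := Nat.mul_le_mul_right _ hstep
      _ = K * (A.card * (K + 1) ^ Y.card) := by ring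
      _ ≤ K * (K ^ Y.card * 2 ^ I.card) := Nat.mul_le_mul_left _ ih
      _ = _ := by ring

/-- This is `(1 - 1/K)^K ≤ 1/2`, from the two leading terms of the binomial expansion of `((K - 1) +
1)^K`. -/
theorem two_mul_pred_pow_le (K : ℕ) (hK : 0 < K) : 2 * (K - 1) ^ K ≤ K ^ K := by
  obtain ⟨a, rfl⟩ : ∃ a, K = a + 1 := ⟨K - 1, by omega⟩
  rw [Nat.add_sub_cancel]
  rw [add_pow, Finset.sum_range_succ, Finset.sum_range_succ]
  simp only [one_pow, mul_one, Nat.sub_self, pow_zero]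
  have h1 : (a + 1).choose a = a + 1 := by simp
  rw [h1, Nat.choose_self, pow_succ]
  push_cast
  nlinarith [Nat.zero_le (a ^ a), Nat.zero_le (∑ x ∈ Finset.range a, a ^ x * ((a + 1).choose x))]

/-- Each block of `2 ^ k` disjoint sets at least halves the number of survivors. -/
theorem card_filter_forall_not_subset_le {ι κ : Type*} [DecidableEq ι] [DecidableEq κ] (k e : ℕ)
    (S : κ → Finset ι) (I : Finset ι) (Y : Finset κ) (hdisj : (Y : Set κ).PairwiseDisjoint S)
    (hk : ∀ y ∈ Y, (S y).card ≤ k) (hI : ∀ y ∈ Y, S y ⊆ I) (hY : Y.card = 2 ^ k * e)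
    (he : e ≤ I.card) :
    (I.powerset.filter fun s => ∀ y ∈ Y, ¬ S y ⊆ s).card ≤ 2 ^ (I.card - e) := by
  have h := card_filter_forall_not_subset k S I Y hdisj hk hI
  set c := (I.powerset.filter fun s => ∀ y ∈ Y, ¬ S y ⊆ s).card
  rw [hY, pow_mul, pow_mul] at h
  set K := 2 ^ k with hK
  have hKpos : 0 < K := by positivity
  have h2 : 2 ^ e * ((K - 1) ^ K) ^ e ≤ (K ^ K) ^ e := by
    rw [← mul_pow]
    exact Nat.pow_le_pow_left (two_mul_pred_pow_le K hKpos) e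
  have hpos : 0 < (K ^ K) ^ e := by positivity
  have h3 : c * 2 ^ e ≤ 2 ^ I.card := by
    refine Nat.le_of_mul_le_mul_right ?_ hpos
    calc c * 2 ^ e * (K ^ K) ^ e = 2 ^ e * (c * (K ^ K) ^ e) := by ring
      _ ≤ 2 ^ e * (((K - 1) ^ K) ^ e * 2 ^ I.card) := Nat.mul_le_mul_left _ h
      _ = (2 ^ e * ((K - 1) ^ K) ^ e) * 2 ^ I.card := by ring
      _ ≤ (K ^ K) ^ e * 2 ^ I.card := Nat.mul_le_mul_right _ h2
      _ = _ := by ring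
  refine Nat.le_of_mul_le_mul_right (h3.trans_eq ?_) (show 0 < 2 ^ e by positivity)
  rw [← pow_add, Nat.sub_add_cancel he]

/-- If a recursive predicate `G w y` says that `y` lies in an infinite set `Y` and that the word
`w` takes the value `true` on a finite set `S y`, where the sets `S y` are disjoint and of bounded
size, then `G` holds for some initial word of each KC-string and some `y`. -/
theorem exists_of_isKCString {U : List Bool →. List Bool} (hU : IsUniversalPrefixAlgorithm U)
    {ε : ℕ → Bool} (hε : IsKCString U ε) {G : List Bool → ℕ → Prop}
    (hG : ComputablePred fun x : List Bool × ℕ => G x.1 x.2) {Y : Set ℕ} (hY : Y.Infinite)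
    (S : ℕ → Finset ℕ) {k : ℕ} (hk : ∀ y ∈ Y, (S y).card ≤ k) (hdisj : Y.PairwiseDisjoint S)
    (hGS : ∀ w y, G w y ↔ y ∈ Y ∧ ∀ i ∈ S y, w[i]? = some true) :
    ∃ n y, G (initialWord ε n) y := by
  classical
  by_contra! hcon
  have hunary : ∀ n i, ((List.range n).map fun _ => true)[i]? = some true ↔ i < n := by
    intro n i
    simp [List.getElem?_eq_some_iff]
  -- On an all-true word, `G` tests whether `y ∈ Y` and `S y` lies below its length. So suitable
  -- points and a word length can be found effectively from `G` alone. The count uses `2 * e`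
  -- because the unary parameter costs `e` bits back.
  have hex : ∀ e : ℕ, ∃ x : List ℕ × ℕ, (x.1.Nodup ∧ x.1.length = 2 ^ k * (2 * e)) ∧
      (∀ y ∈ x.1, G ((List.range x.2).map fun _ => true) y) ∧ 2 * e ≤ x.2 := by
    intro e
    obtain ⟨t, htY, ht⟩ := hY.exists_subset_card_eq (2 ^ k * (2 * e))
    refine ⟨(t.toList, (t.biUnion S).sup Nat.succ + 2 * e),
      ⟨t.nodup_toList, by simpa using ht⟩, fun y hy => ?_, Nat.le_add_left _ _⟩
    have hyt : y ∈ t := by simpa using hy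
    refine (hGS _ _).2 ⟨htY hyt, fun i hi => (hunary _ _).2 ?_⟩
    have : i.succ ≤ (t.biUnion S).sup Nat.succ :=
      Finset.le_sup (f := Nat.succ) (Finset.mem_biUnion.2 ⟨y, hyt, hi⟩)
    dsimp only
    omega
  obtain ⟨f, hf, hfs⟩ := ComputablePred.exists_computable_choice (by
    refine .and (.and ?_ ?_) (.and ?_ ?_)
    · exact .nodup (Computable.fst.comp .snd)
    · exact .eq (Computable.list_length.comp (Computable.fst.comp .snd))
        (Primrec.nat_mul.to_comp.comp (Computable.const _)
          (Primrec.nat_mul.to_comp.comp (Computable.const _) .fst))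
    · refine ComputablePred.forall_mem_list
        (p := fun (x : ℕ × List ℕ × ℕ) y => G ((List.range x.2.2).map fun _ => true) y)
        (Computable.fst.comp .snd) ?_
      exact hG.comp ((computable_unary.comp
        (Computable.snd.comp (Computable.snd.comp .fst))).pair .snd)
    · exact .le (Primrec.nat_mul.to_comp.comp (Computable.const _) .fst)
        (Computable.snd.comp .snd)) hex
  refine not_isKCString_of_small hU (ε := ε)
    (Q := fun e w => w.length = (f e).2 ∧ ∀ y ∈ (f e).1, ¬ G w y) ?_
    (M := fun e => (f e).2) (Computable.snd.comp hf) (fun e => (hfs e).2.2) (fun e w h => h.1) ?_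
    (fun e => ⟨length_initialWord _ _, fun y _ => hcon _ y⟩) hε
  · refine .and (.eq (Computable.list_length.comp .snd)
      (Computable.snd.comp (hf.comp .fst))) ?_
    exact ComputablePred.forall_mem_list (p := fun (x : ℕ × List Bool) y => ¬ G x.2 y)
      (Computable.fst.comp (hf.comp .fst))
      (hG.comp ((Computable.snd.comp .fst).pair .snd)).not
  · intro e
    obtain ⟨⟨hnd, hlen⟩, hmem, hle⟩ := hfs e
    generalize f e = x at hnd hlen hmem hle
    obtain ⟨ys, M⟩ := x
    dsimp only at hnd hlen hmem hle ⊢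
    have hys : ∀ y ∈ ys.toFinset, y ∈ Y ∧ S y ⊆ Finset.range M := fun y hy => by
      have := (hGS _ _).1 (hmem y (List.mem_toFinset.1 hy))
      exact ⟨this.1, fun i hi => Finset.mem_range.2 ((hunary _ _).1 (this.2 i hi))⟩
    have hmain := card_filter_forall_not_subset_le k (2 * e) S (Finset.range M) ys.toFinset
      (hdisj.subset fun y hy => (hys y hy).1) (fun y hy => hk y (hys y hy).1)
      (fun y hy => (hys y hy).2) (by rw [List.toFinset_card_of_nodup hnd, hlen]) (by simpa using hle)
    rw [Finset.card_range] at hmain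
    refine le_trans ?_ hmain
    rw [← Set.ncard_coe_finset]
    -- Words of length `M` are identified with their sets of true positions.
    refine Set.ncard_le_ncard_of_injOn
      (fun w => (Finset.range M).filter fun i => w[i]? = some true) ?_ ?_ (Finset.finite_toSet _)
    · rintro w ⟨hw, hwG⟩
      simp only [Finset.coe_filter, Set.mem_ofPred_eq, Finset.mem_powerset, Finset.filter_subset,
        true_and]
      intro y hy hsub
      refine hwG y (List.mem_toFinset.1 hy) ((hGS _ _).2 ⟨(hys y hy).1, fun i hi => ?_⟩)
      exact (Finset.mem_filter.1 (hsub hi)).2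
    · rintro w ⟨hw, -⟩ w' ⟨hw', -⟩ h
      refine List.ext_getElem (hw.trans hw'.symm) fun i h1 h2 => ?_
      have := Finset.ext_iff.1 h i
      simp only [Finset.mem_filter, Finset.mem_range, List.getElem?_eq_getElem h1,
        List.getElem?_eq_getElem h2, Option.some.injEq, hw ▸ h1, true_and] at this
      exact Bool.eq_iff_iff.2 this

end KCHom

/-! ### Quantifier-free types, homogeneity and infinite orbits. -/

namespace FirstOrder.Language

open Structure

variable {L : FirstOrder.Language.{u, v}}

section SameType

variable {M N P ι : Type*} [L.Structure M] [L.Structure N] [L.Structure P]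

variable (L) in
/-- Two families of elements of structures have the same quantifier-free type in a relational
language. -/
def SameType (f : ι → M) (g : ι → N) : Prop :=
  (∀ i j, f i = f j ↔ g i = g j) ∧
    ∀ (R : Σ n, L.Relations n) (t : Fin R.1 → ι), RelMap R.2 (f ∘ t) ↔ RelMap R.2 (g ∘ t)

theorem SameType.symm {f : ι → M} {g : ι → N} (h : L.SameType f g) : L.SameType g f :=
  ⟨fun i j => (h.1 i j).symm, fun R t => (h.2 R t).symm⟩

theorem SameType.trans {f : ι → M} {g : ι → N} {k : ι → P} (h : L.SameType f g)
    (h' : L.SameType g k) : L.SameType f k :=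
  ⟨fun i j => (h.1 i j).trans (h'.1 i j), fun R t => (h.2 R t).trans (h'.2 R t)⟩

theorem Embedding.sameType (φ : M ↪[L] N) (f : ι → M) : L.SameType f (φ ∘ f) :=
  ⟨fun _ _ => φ.injective.eq_iff.symm, fun R t => (φ.map_rel R.2 (f ∘ t)).symm⟩

theorem SameType.exists_embedding [L.IsRelational] {f : ι → M} {g : ι → N}
    (h : L.SameType f g) (hf : Function.Surjective f) : ∃ φ : M ↪[L] N, ∀ i, φ (f i) = g i := by
  choose s hs using hf
  have key : ∀ i, g (s (f i)) = g i := fun i => (h.1 _ _).1 (hs (f i))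
  refine ⟨⟨⟨g ∘ s, fun x y hxy => ?_⟩, fun F => isEmptyElim F, fun {n} r x => ?_⟩, key⟩
  · rw [← hs x, ← hs y]
    exact (h.1 _ _).2 hxy
  · have := h.2 ⟨n, r⟩ (s ∘ x)
    rw [show f ∘ s ∘ x = x from funext fun i => hs (x i)] at this
    exact this.symm

/-- In a relational language the range of a finite family is already a substructure, so equality of
types is an isomorphism of finite substructures. -/
theorem IsUltrahomogeneous.exists_equiv_of_sameType [L.IsRelational] [Finite ι]
    (hM : L.IsUltrahomogeneous M) {f g : ι → M} (h : L.SameType f g) :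
    ∃ φ : M ≃[L] M, ∀ i, φ (f i) = g i := by
  let S := Substructure.closure L (Set.range f)
  have hS : ∀ i, f i ∈ S := fun i => Substructure.subset_closure ⟨i, rfl⟩
  let f' : ι → S := fun i => ⟨f i, hS i⟩
  have hf' : L.SameType f' g := (S.subtype.sameType f').trans h
  have hsurj : Function.Surjective f' := by
    rintro ⟨x, hx⟩
    obtain ⟨i, rfl⟩ := (Substructure.mem_closure_iff_of_isRelational L _ _).1 hx
    exact ⟨i, rfl⟩
  obtain ⟨ψ, hψ⟩ := hf'.exists_embedding hsurj
  obtain ⟨φ, hφ⟩ := hM S (Substructure.fg_closure (Set.finite_range f)) ψ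
  refine ⟨φ, fun i => ?_⟩
  rw [← hψ i, hφ]
  rfl

end SameType

/-- In an ultrahomogeneous relational structure with dense age, the orbit over a finite set of an
element outside this set is infinite. -/
theorem IsUltrahomogeneous.infinite_orbit [L.IsRelational] {M : Type w} [L.Structure M]
    (hM : L.IsUltrahomogeneous M) (hdense : KCHom.HasDenseAge L M) {A : Set M} (hA : A.Finite)
    {c : M} (hc : c ∉ A) : {y | ∃ φ : M ≃[L] M, (∀ a ∈ A, φ a = a) ∧ φ c = y}.Infinite := by
  -- If the orbit `O` is finite, two copies of `A ∪ O` are amalgamated over `A` and put back into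
  -- `M` so that `A` is fixed. Each copy of `O` then fills all of `O`, so both contain `c`; but they
  -- may meet only in `A`.
  intro hO
  set O := {y | ∃ φ : M ≃[L] M, (∀ a ∈ A, φ a = a) ∧ φ c = y}
  let SA := Substructure.closure L A
  let SB := Substructure.closure L (A ∪ O)
  have hSA : SA.FG := Substructure.fg_closure hA
  have hSB : SB.FG := Substructure.fg_closure (hA.union hO)
  have hle : SA ≤ SB := Substructure.closure_mono Set.subset_union_left
  have hBO : ∀ o ∈ O, o ∈ SB := fun o ho => Substructure.subset_closure (Or.inr ho)
  have hAA : ∀ a ∈ A, a ∈ SA := fun a ha => Substructure.subset_closure ha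
  obtain ⟨C, ⟨-, ⟨r⟩⟩, f₁, f₂, hcomp, hrange⟩ := hdense (Bundled.of SA)
    ⟨(Substructure.fg_iff_structure_fg _).1 hSA, ⟨SA.subtype⟩⟩ (Bundled.of SB)
    ⟨(Substructure.fg_iff_structure_fg _).1 hSB, ⟨SB.subtype⟩⟩ (Substructure.inclusion hle)
  have : Nonempty (C ↪[L] M) := ⟨r⟩
  obtain ⟨f', hf'⟩ := hM.extend_embedding ((Substructure.fg_iff_structure_fg _).1 hSA) SA.subtype
    (f₁.comp (Substructure.inclusion hle))
  have hsurj : ∀ f : SB ↪[L] C, f.comp (Substructure.inclusion hle) =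
      f₁.comp (Substructure.inclusion hle) → ∃ o : SB, (o : M) ∈ O ∧ f' (f o) = c := by
    intro f hf
    obtain ⟨φ, hφ⟩ := hM SB hSB (f'.comp f)
    have hφ' : ∀ x : SB, f' (f x) = φ x := fun x => DFunLike.congr_fun hφ x
    have hfix : ∀ a ∈ A, φ a = a := by
      intro a ha
      have h1 := DFunLike.congr_fun hf ⟨a, hAA a ha⟩
      have h2 := DFunLike.congr_fun hf' ⟨a, hAA a ha⟩
      have h3 := hφ' (Substructure.inclusion hle ⟨a, hAA a ha⟩)
      refine Eq.trans h3.symm (Eq.trans ?_ h2.symm)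
      exact congrArg f' h1
    have hmaps : Set.MapsTo φ O O := by
      rintro o ⟨ψ, hψ, rfl⟩
      exact ⟨φ.comp ψ, fun a ha => by simp [hψ a ha, hfix a ha], rfl⟩
    -- An injective self-map of the finite set `O` is onto.
    obtain ⟨o, ho, hoc⟩ := ((hO.injOn_iff_bijOn_of_mapsTo hmaps).1 φ.injective.injOn).surjOn
      (show c ∈ O from ⟨Equiv.refl L M, fun _ _ => rfl, rfl⟩)
    exact ⟨⟨o, hBO o ho⟩, ho, (hφ' _).trans hoc⟩
  obtain ⟨o₁, ho₁, h₁⟩ := hsurj f₁ rfl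
  obtain ⟨o₂, ho₂, h₂⟩ := hsurj f₂ hcomp.symm
  have h12 : f₁ o₁ = f₂ o₂ := f'.injective (h₁.trans h₂.symm)
  have hmem : f₁ o₁ ∈ Set.range f₁ ∩ Set.range f₂ := ⟨⟨o₁, rfl⟩, ⟨o₂, h12.symm⟩⟩
  rw [hrange] at hmem
  obtain ⟨(a : SA), ha⟩ := hmem
  have hao : Substructure.inclusion hle a = o₁ := f₁.injective ha
  have haA : (a : M) ∈ A := (Substructure.mem_closure_iff_of_isRelational L _ _).1 a.2
  have hao' : (a : M) = o₁ := congrArg Subtype.val hao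
  obtain ⟨φ, hφ, hφc⟩ := ho₁
  have : φ a = φ c := by rw [hφ a haA, hφc, hao']
  exact hc (φ.injective this ▸ haA)

end FirstOrder.Language

/-! ### Finite partial embeddings coded by lists, and the decidable extension step. -/

namespace KCHom

open FirstOrder.Language FirstOrder.Language.Structure

/-- The first `n` entries of a list. -/
def listFamily (n : ℕ) (l : List ℕ) (i : Fin n) : ℕ := l.getD i 0

theorem listFamily_range (n : ℕ) : listFamily n (List.range n) = Fin.val := by
  funext i
  simp [listFamily]

theorem listFamily_length (l : List ℕ) (i : Fin l.length) : listFamily l.length l i = l[i] := by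
  simp [listFamily]

/-- All lists of length `r` with entries from a list. -/
def tuples : ℕ → List ℕ → List (List ℕ)
  | 0, _ => [List.nil]
  | r + 1, l => l.flatMap fun x => (tuples r l).map fun t => x :: t

theorem mem_tuples {r : ℕ} {l t : List ℕ} :
    t ∈ tuples r l ↔ t.length = r ∧ ∀ x ∈ t, x ∈ l := by
  induction r generalizing t with
  | zero =>
    simp only [tuples, List.mem_singleton, List.length_eq_zero_iff]
    constructor
    · rintro rfl
      simp
    · exact fun h => h.1
  | succ r ih =>
    simp only [tuples, List.mem_flatMap, List.mem_map]
    constructor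
    · rintro ⟨x, hx, s, hs, rfl⟩
      obtain ⟨h1, h2⟩ := ih.1 hs
      simpa [h1, hx] using h2
    · rintro ⟨h1, h2⟩
      cases t with
      | nil => simp at h1
      | cons x s =>
        simp only [List.length_cons, Nat.add_right_cancel_iff, List.mem_cons,
          forall_eq_or_imp] at h1 h2
        exact ⟨x, h2.1, s, ih.2 ⟨h1, h2.2⟩, rfl⟩

theorem primrec_tuples (r : ℕ) : Primrec (tuples r) := by
  induction r with
  | zero => exact Primrec.const _
  | succ r ih =>
    have h : Primrec₂ fun (l : List ℕ) (x : ℕ) => (tuples r l).map fun t => x :: t :=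
      Primrec.list_map (ih.comp .fst) (Primrec.list_cons.comp (Primrec.snd.comp .fst) .snd).to₂
    exact Primrec.list_flatMap Primrec.id h

theorem primrec_fin_pi {α σ : Type*} [Primcodable α] [Primcodable σ] {n : ℕ} {f : α → Fin n → σ}
    (h : ∀ i, Primrec fun a => f a i) : Primrec f :=
  Primrec.fin_curry.2 (Primrec.fin_curry₁ (f := fun i a => f a i) |>.2 h).swap

variable {L : FirstOrder.Language.{u, v}} [L.Structure ℕ]

/-- Only bounded quantifiers remain besides the one over relation symbols, so finiteness of the
signature yields decidability. -/
theorem sameType_listFamily_iff {n : ℕ} {a b : List ℕ} :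
    L.SameType (listFamily n a) (listFamily n b) ↔
      (∀ i < n, ∀ j < n, a.getD i 0 = a.getD j 0 ↔ b.getD i 0 = b.getD j 0) ∧
      ∀ R : Σ n, L.Relations n, ∀ t ∈ tuples R.1 (List.range n),
        RelMap R.2 (fun i : Fin R.1 => a.getD (t.getD i 0) 0) ↔
          RelMap R.2 (fun i : Fin R.1 => b.getD (t.getD i 0) 0) := by
  refine and_congr ?_ (forall_congr' fun R => ?_)
  · exact ⟨fun h i hi j hj => h ⟨i, hi⟩ ⟨j, hj⟩, fun h i j => h i i.2 j j.2⟩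
  · constructor
    · intro h t ht
      obtain ⟨h1, h2⟩ := mem_tuples.1 ht
      have hlt : ∀ i : Fin R.1, t.getD i 0 < n := fun i => by
        have hi : (i : ℕ) < t.length := by rw [h1]; exact i.2
        rw [List.getD_eq_getElem _ _ hi]
        exact List.mem_range.1 (h2 _ (List.getElem_mem hi))
      exact h fun i => ⟨t.getD i 0, hlt i⟩
    · intro h t
      have := h (List.ofFn fun i => (t i : ℕ)) (mem_tuples.2 ⟨by simp, fun x hx => by
        obtain ⟨i, rfl⟩ := (List.mem_ofFn' _ _).1 hx
        simp⟩)
      simpa [listFamily, Function.comp_def] using this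

theorem computablePred_sameType [Finite (Σ n : ℕ, L.Relations n)] (hrec : IsRecursiveStructure L) :
    ComputablePred fun x : ℕ × List ℕ × List ℕ =>
      L.SameType (listFamily x.1 x.2.1) (listFamily x.1 x.2.2) := by
  have ha : Primrec fun x : ℕ × List ℕ × List ℕ => x.2.1 := Primrec.fst.comp .snd
  have hb : Primrec fun x : ℕ × List ℕ × List ℕ => x.2.2 := Primrec.snd.comp .snd
  have hget {f : ℕ × List ℕ × List ℕ → List ℕ} (hf : Primrec f) :
      Primrec₂ fun (x : ℕ × List ℕ × List ℕ) (i : ℕ) => (f x).getD i 0 :=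
    (Primrec.list_getD 0).comp (hf.comp .fst) .snd
  have hrel {f : ℕ × List ℕ × List ℕ → List ℕ} (hf : Primrec f) (R : Σ n, L.Relations n) :
      ComputablePred fun x : (ℕ × List ℕ × List ℕ) × List ℕ =>
        RelMap R.2 (fun i : Fin R.1 => (f x.1).getD (x.2.getD i 0) 0) := by
    refine (hrec R.1 R.2).comp (Primrec.to_comp (primrec_fin_pi fun i => ?_))
    exact (hget hf).comp .fst ((Primrec.list_getD 0).comp .snd (Primrec.const _))
  have hpair {f : ℕ × List ℕ × List ℕ → List ℕ} (hf : Primrec f) :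
      ComputablePred fun x : ((ℕ × List ℕ × List ℕ) × ℕ) × ℕ =>
        (f x.1.1).getD x.1.2 0 = (f x.1.1).getD x.2 0 :=
    .eq ((hget hf).comp (Primrec.fst.comp .fst) (Primrec.snd.comp .fst)).to_comp
      ((hget hf).comp (Primrec.fst.comp .fst) .snd).to_comp
  refine ComputablePred.of_eq (.and ?_ (.forall_finite fun R => ?_))
    fun x => sameType_listFamily_iff.symm
  · refine .forall_lt (p := fun (x : ℕ × List ℕ × List ℕ) i => ∀ j < x.1,
      x.2.1.getD i 0 = x.2.1.getD j 0 ↔ x.2.2.getD i 0 = x.2.2.getD j 0) .fst ?_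
    exact .forall_lt (p := fun (x : (ℕ × List ℕ × List ℕ) × ℕ) j =>
      x.1.2.1.getD x.2 0 = x.1.2.1.getD j 0 ↔ x.1.2.2.getD x.2 0 = x.1.2.2.getD j 0)
      (Computable.fst.comp .fst) ((hpair ha).iff (hpair hb))
  · exact .forall_mem_list (p := fun (x : ℕ × List ℕ × List ℕ) t =>
      RelMap R.2 (fun i : Fin R.1 => x.2.1.getD (t.getD i 0) 0) ↔
          RelMap R.2 (fun i : Fin R.1 => x.2.2.getD (t.getD i 0) 0))
      ((primrec_tuples R.1).comp (Primrec.list_range.comp .fst)).to_comp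
      ((hrel ha R).iff (hrel hb R))

variable (L) in
/-- The list `σ ++ [y]` lists the values of a finite partial embedding with domain an initial
segment, and the word `w` certifies that each set containing `y` and listed by a tuple of the same
type as `t₀` from this list has colour `true`, where `l` lists the sets that are coloured. -/
def IsGoodExtension (l : ℕ → List ℕ) (t₀ : List ℕ) (w : List Bool) (σ : List ℕ) (y : ℕ) : Prop :=
  L.SameType (listFamily (σ.length + 1) (List.range (σ.length + 1)))
      (listFamily (σ.length + 1) (σ ++ [y])) ∧
    ∀ τ ∈ tuples t₀.length (σ ++ [y]), y ∈ τ →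
      L.SameType (listFamily t₀.length τ) (listFamily t₀.length t₀) →
        ∃ i < w.length, w[i]? = some true ∧ (∀ x ∈ l i, x ∈ τ) ∧ ∀ x ∈ τ, x ∈ l i

theorem computablePred_isGoodExtension [Finite (Σ n : ℕ, L.Relations n)]
    (hrec : IsRecursiveStructure L) {l : ℕ → List ℕ} (hl : Computable l) (t₀ : List ℕ) :
    ComputablePred fun x : List Bool × List ℕ × ℕ => IsGoodExtension L l t₀ x.1 x.2.1 x.2.2 := by
  have hσ : Computable fun x : List Bool × List ℕ × ℕ => x.2.1 := Computable.fst.comp .snd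
  have hy : Computable fun x : List Bool × List ℕ × ℕ => x.2.2 := Computable.snd.comp .snd
  have hσy : Computable fun x : List Bool × List ℕ × ℕ => x.2.1 ++ [x.2.2] :=
    Computable.list_concat.comp hσ hy
  have hn : Computable fun x : List Bool × List ℕ × ℕ => x.2.1.length + 1 :=
    Computable.succ.comp (Computable.list_length.comp hσ)
  refine .and ?_ ?_
  · exact (computablePred_sameType hrec).comp
      (hn.pair ((Primrec.list_range.to_comp.comp hn).pair hσy))
  · refine .forall_mem_list (p := fun (x : List Bool × List ℕ × ℕ) τ => x.2.2 ∈ τ →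
      L.SameType (listFamily t₀.length τ) (listFamily t₀.length t₀) →
        ∃ i < x.1.length, x.1[i]? = some true ∧ (∀ z ∈ l i, z ∈ τ) ∧ ∀ z ∈ τ, z ∈ l i)
      ((primrec_tuples _).to_comp.comp hσy) (.imp (.mem_list (hy.comp .fst) .snd) (.imp ?_ ?_))
    · exact (computablePred_sameType hrec).comp
        ((Computable.const _).pair (Computable.snd.pair (Computable.const _)))
    · refine .exists_lt (p := fun (x : (List Bool × List ℕ × ℕ) × List ℕ) i =>
        x.1.1[i]? = some true ∧ (∀ z ∈ l i, z ∈ x.2) ∧ ∀ z ∈ x.2, z ∈ l i)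
        (Computable.list_length.comp (Computable.fst.comp .fst)) (.and ?_ (.and ?_ ?_))
      · exact .eq (Computable.list_getElem?.comp
          (Computable.fst.comp (Computable.fst.comp .fst)) .snd) (Computable.const _)
      · exact .forall_mem_list
          (p := fun (x : ((List Bool × List ℕ × ℕ) × List ℕ) × ℕ) z => z ∈ x.1.2)
          (hl.comp .snd) (.mem_list .snd (Computable.snd.comp (Computable.fst.comp .fst)))
      · exact .forall_mem_list
          (p := fun (x : ((List Bool × List ℕ × ℕ) × List ℕ) × ℕ) z => z ∈ l x.2)
          (Computable.snd.comp .fst) (.mem_list .snd (hl.comp (Computable.snd.comp .fst)))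

/-- A listing of one copy serves as a finite constant standing for `β` in algorithms. -/
theorem exists_list_mem_copies_iff [L.IsRelational] (β : Type w) [L.Structure β] [Finite β]
    (f₀ : β ↪[L] ℕ) : ∃ t₀ : List ℕ, ∀ s : Finset ℕ, s ∈ copies L β ↔ ∃ τ : List ℕ,
      τ.length = t₀.length ∧
        L.SameType (listFamily t₀.length τ) (listFamily t₀.length t₀) ∧ τ.toFinset = s := by
  obtain ⟨r, ⟨e⟩⟩ := Finite.exists_equiv_fin β
  have hfam : ∀ f : β → ℕ, listFamily r (List.ofFn (f ∘ e.symm)) = f ∘ e.symm := fun f => by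
    funext i
    simp [listFamily]
  refine ⟨List.ofFn (f₀ ∘ e.symm), fun s => ?_⟩
  rw [List.length_ofFn, hfam]
  constructor
  · rintro ⟨f, hf⟩
    refine ⟨List.ofFn (f ∘ e.symm), List.length_ofFn, ?_, ?_⟩
    · rw [hfam]
      exact (f.sameType e.symm).symm.trans (f₀.sameType e.symm)
    · ext x
      rw [List.mem_toFinset, List.mem_ofFn', ← Finset.mem_coe, ← hf]
      simp
  · rintro ⟨τ, rfl, hτ, rfl⟩
    obtain ⟨φ, hφ⟩ := ((f₀.sameType e.symm).trans hτ.symm).exists_embedding e.symm.surjective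
    refine ⟨φ, ?_⟩
    ext x
    rw [Finset.mem_coe, List.mem_toFinset, List.mem_iff_getElem]
    constructor
    · rintro ⟨z, rfl⟩
      refine ⟨e z, (e z).2, ?_⟩
      have := hφ (e z)
      rw [e.symm_apply_apply, listFamily_length] at this
      exact this.symm
    · rintro ⟨i, hi, rfl⟩
      exact ⟨e.symm ⟨i, hi⟩, (hφ ⟨i, hi⟩).trans (listFamily_length _ _)⟩

/-- The indices of the sets of a family that contain `y` and are contained in `insert y A`. -/
noncomputable def newIndices {S : Set (Finset ℕ)} (b : ℕ ≃ S) (A : Finset ℕ) (y : ℕ) : Finset ℕ :=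
  ((insert y A).powerset.preimage (fun i => (b i : Finset ℕ))
    (Subtype.val_injective.comp b.injective).injOn).filter fun i => y ∈ (b i : Finset ℕ)

theorem mem_newIndices {S : Set (Finset ℕ)} {b : ℕ ≃ S} {A : Finset ℕ} {y i : ℕ} :
    i ∈ newIndices b A y ↔ (b i : Finset ℕ) ⊆ insert y A ∧ y ∈ (b i : Finset ℕ) := by
  simp [newIndices]

theorem card_newIndices_le {S : Set (Finset ℕ)} (b : ℕ ≃ S) (A : Finset ℕ) (y : ℕ) :
    (newIndices b A y).card ≤ 2 ^ (A.card + 1) := by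
  calc (newIndices b A y).card ≤ (insert y A).powerset.card :=
        Finset.card_le_card_of_injOn (fun i => (b i : Finset ℕ))
          (fun i hi => Finset.mem_coe.2 (Finset.mem_powerset.2 (mem_newIndices.1 hi).1))
          (Subtype.val_injective.comp b.injective).injOn
    _ ≤ _ := by
        rw [Finset.card_powerset]
        exact Nat.pow_le_pow_right (by norm_num) (Finset.card_insert_le _ _)

/-- A set containing `y` and contained in `insert z A` would force `y = z` or `y ∈ A`. -/
theorem disjoint_newIndices {S : Set (Finset ℕ)} {b : ℕ ≃ S} {A : Finset ℕ} {y z : ℕ}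
    (hy : y ∉ A) (hyz : y ≠ z) : Disjoint (newIndices b A y) (newIndices b A z) := by
  refine Finset.disjoint_left.2 fun i hi hi' => ?_
  rcases Finset.mem_insert.1 ((mem_newIndices.1 hi').1 (mem_newIndices.1 hi).2) with h | h
  exacts [hyz h, hy h]

/-- Translates the decidable condition into the form required by `exists_of_isKCString`. -/
theorem isGoodExtension_iff {β : Type w} [L.Structure β] {b : ℕ ≃ copies L β} {l : ℕ → List ℕ}
    (hl : ∀ i, (l i).toFinset = (b i : Finset ℕ)) {t₀ : List ℕ}
    (ht₀ : ∀ s : Finset ℕ, s ∈ copies L β ↔ ∃ τ : List ℕ, τ.length = t₀.length ∧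
      L.SameType (listFamily t₀.length τ) (listFamily t₀.length t₀) ∧ τ.toFinset = s)
    {w : List Bool} {σ : List ℕ} {y : ℕ} :
    IsGoodExtension L l t₀ w σ y ↔
      L.SameType (listFamily (σ.length + 1) (List.range (σ.length + 1)))
          (listFamily (σ.length + 1) (σ ++ [y])) ∧
        ∀ i ∈ newIndices b σ.toFinset y, w[i]? = some true := by
  have hset : ∀ i (τ : List ℕ),
      ((∀ x ∈ l i, x ∈ τ) ∧ ∀ x ∈ τ, x ∈ l i) ↔ (b i : Finset ℕ) = τ.toFinset := by
    intro i τ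
    rw [← hl i, Finset.ext_iff]
    simp only [List.mem_toFinset]
    exact ⟨fun h x => ⟨h.1 x, h.2 x⟩, fun h => ⟨fun x => (h x).1, fun x => (h x).2⟩⟩
  simp only [IsGoodExtension, hset]
  refine and_congr_right fun _ => ⟨fun h i hi => ?_, fun h τ hτ hyτ hτt => ?_⟩
  · obtain ⟨hsub, hy⟩ := mem_newIndices.1 hi
    obtain ⟨τ, hlen, hτ, hτi⟩ := (ht₀ _).1 (b i).2
    rw [← hτi] at hsub hy
    obtain ⟨j, -, hj, hji⟩ := h τ (mem_tuples.2 ⟨hlen, fun x hx => by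
      simpa [or_comm] using hsub (List.mem_toFinset.2 hx)⟩) (List.mem_toFinset.1 hy) hτ
    have : j = i := b.injective (Subtype.ext (hji.trans hτi))
    rwa [this] at hj
  · obtain ⟨hlen, hsub⟩ := mem_tuples.1 hτ
    have hc := (ht₀ τ.toFinset).2 ⟨τ, hlen, hτt, rfl⟩
    have hbi : (b (b.symm ⟨_, hc⟩) : Finset ℕ) = τ.toFinset := by rw [Equiv.apply_symm_apply]
    have hw := h (b.symm ⟨_, hc⟩) (mem_newIndices.2 (by
      rw [hbi]
      refine ⟨fun x hx => ?_, List.mem_toFinset.2 hyτ⟩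
      simpa [or_comm] using hsub x (List.mem_toFinset.1 hx)))
    exact ⟨_, (List.getElem?_eq_some_iff.1 hw).1, hw, hbi⟩

/-- An automorphism `g` extending `σ` provides one next value, `g σ.length`, outside `σ`; every
point of its orbit over `σ` does as well. -/
theorem infinite_sameType_append [L.IsRelational] (hhom : L.IsUltrahomogeneous ℕ)
    (hdense : HasDenseAge L ℕ) {σ : List ℕ}
    (hσ : L.SameType (listFamily σ.length (List.range σ.length)) (listFamily σ.length σ)) :
    {y | L.SameType (listFamily (σ.length + 1) (List.range (σ.length + 1)))
      (listFamily (σ.length + 1) (σ ++ [y]))}.Infinite := by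
  obtain ⟨g, hg⟩ := hhom.exists_equiv_of_sameType hσ
  have hg' : ∀ i (hi : i < σ.length), g i = σ[i] := fun i hi => by
    have := hg ⟨i, hi⟩
    rwa [listFamily_range, listFamily_length] at this
  have hc : g σ.length ∉ {x | x ∈ σ} := by
    intro h
    obtain ⟨i, hi, h⟩ := List.mem_iff_getElem.1 h
    rw [← hg' i hi] at h
    exact hi.ne (g.injective h)
  refine (hhom.infinite_orbit hdense (List.finite_toSet σ) hc).mono ?_
  rintro y ⟨φ, hφ, rfl⟩
  have := (φ.comp g).toEmbedding.sameType
    (listFamily (σ.length + 1) (List.range (σ.length + 1)))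
  rw [Set.mem_ofPred_eq]
  convert this using 1
  funext i
  rw [listFamily_range]
  change (σ ++ [φ (g σ.length)]).getD i 0 = φ (g i)
  rcases (Nat.lt_succ_iff.1 i.2).lt_or_eq with h | h
  · rw [List.getD_append _ _ _ _ h, List.getD_eq_getElem _ _ h, hg' _ h]
    exact (hφ _ (List.getElem_mem h)).symm
  · rw [h, List.getD_append_right _ _ _ _ le_rfl]
    simp

theorem notMem_of_sameType_append {σ : List ℕ} {y : ℕ}
    (h : L.SameType (listFamily (σ.length + 1) (List.range (σ.length + 1)))
      (listFamily (σ.length + 1) (σ ++ [y]))) : y ∉ σ := by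
  intro hy
  obtain ⟨i, hi, rfl⟩ := List.mem_iff_getElem.1 hy
  have := (h.1 ⟨i, by omega⟩ ⟨σ.length, by omega⟩).2 (by
    simp [listFamily, List.getElem?_append_left hi, List.getElem?_eq_getElem hi])
  rw [listFamily_range] at this
  exact hi.ne this

end KCHom

/-! ### Recursion and search relative to an oracle. -/

section Oracle

variable {O : Set (ℕ →. ℕ)}

theorem Computable.nat_recursiveIn {f : ℕ → ℕ} (hf : Computable f) :
    Nat.RecursiveIn O (f : ℕ →. ℕ) :=
  (Partrec.nat_iff.1 hf.partrec).recursiveIn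

namespace Nat.RecursiveIn

theorem comp_total {f g : ℕ → ℕ} (hf : Nat.RecursiveIn O (f : ℕ →. ℕ))
    (hg : Nat.RecursiveIn O (g : ℕ →. ℕ)) : Nat.RecursiveIn O ((fun n => f (g n) : ℕ → ℕ) : ℕ →. ℕ) :=
  (hf.comp hg).of_eq fun n => by
    simp only [PFun.coe_val]
    exact Part.bind_some _ _

theorem pair_total {f g : ℕ → ℕ} (hf : Nat.RecursiveIn O (f : ℕ →. ℕ))
    (hg : Nat.RecursiveIn O (g : ℕ →. ℕ)) :
    Nat.RecursiveIn O ((fun n => Nat.pair (f n) (g n) : ℕ → ℕ) : ℕ →. ℕ) :=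
  (hf.pair hg).of_eq fun n => by simp [Seq.seq]

/-- Iteration of a function recursive in an oracle, along a parameter. -/
theorem rec_total {h : ℕ → ℕ} (hh : Nat.RecursiveIn O (h : ℕ →. ℕ)) (a : ℕ) {g : ℕ → ℕ}
    (h0 : g 0 = a) (hs : ∀ n, g (n + 1) = h (Nat.pair n (g n))) :
    Nat.RecursiveIn O (g : ℕ →. ℕ) := by
  have hconst : Nat.RecursiveIn O ((fun _ => a : ℕ → ℕ) : ℕ →. ℕ) :=
    (Computable.const a).nat_recursiveIn
  have hstep : Nat.RecursiveIn O ((fun x => h x.unpair.2 : ℕ → ℕ) : ℕ →. ℕ) :=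
    hh.comp_total (Computable.snd.comp Computable.unpair).nat_recursiveIn
  -- Primitive recursion expects a parameter; 0 is a dummy one.
  have hin : Nat.RecursiveIn O ((fun n => Nat.pair 0 n : ℕ → ℕ) : ℕ →. ℕ) :=
    (Primrec₂.natPair.comp (_root_.Primrec.const 0) _root_.Primrec.id).to_comp.nat_recursiveIn
  refine ((hconst.prec hstep).comp hin).of_eq_tot fun n => ?_
  simp only [PFun.coe_val, Part.bind_eq_bind, Part.bind_some, Nat.unpair_pair]
  induction n with
  | zero => simp [h0]
  | succ n ih => simp [hs, Part.eq_some_iff.2 ih]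

/-- Search relative to an oracle. -/
theorem find_total {h : ℕ → ℕ} (hh : Nat.RecursiveIn O (h : ℕ →. ℕ))
    (hex : ∀ a, ∃ n, h (Nat.pair a n) = 0) :
    Nat.RecursiveIn O ((fun a => Nat.find (hex a) : ℕ → ℕ) : ℕ →. ℕ) := by
  refine hh.rfind.of_eq_tot fun a => ?_
  refine Nat.mem_rfind.2 ⟨?_, fun {m} hm => ?_⟩
  · simpa using Nat.find_spec (hex a)
  · simpa using Nat.find_min (hex a) hm

end Nat.RecursiveIn

end Oracle

namespace KCHom

/-- Recursion in an infinite binary string `ε`, where each value is found by a search for an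
initial word of `ε` which certifies it. -/
theorem exists_recursiveRelativeTo (ε : ℕ → Bool) {T : List Bool → List ℕ → ℕ → Prop}
    (hT : ComputablePred fun x : List Bool × List ℕ × ℕ => T x.1 x.2.1 x.2.2)
    (hex : ∀ σ, ∃ n y, T (initialWord ε n) σ y) :
    ∃ ν : ℕ → ℕ, RecursiveRelativeTo ε ν ∧
      ∀ n, ∃ s, T (initialWord ε s) ((List.range n).map ν) (ν n) := by
  classical
  set O : Set (ℕ →. ℕ) := {((fun n => (ε n).toNat : ℕ → ℕ) : ℕ →. ℕ)}
  have horacle : Nat.RecursiveIn O ((fun n => (ε n).toNat : ℕ → ℕ) : ℕ →. ℕ) :=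
    .oracle _ rfl
  let dec : ℕ → List ℕ := Denumerable.ofNat (List ℕ)
  have hdec : Computable dec := Computable.ofNat _
  let decB : ℕ → List Bool := fun n => (dec n).map fun i => i == 1
  have hdecB : Computable decB :=
    (Primrec.list_map (Primrec.ofNat (List ℕ))
      (Primrec.beq.comp Primrec.snd (Primrec.const 1)).to₂).to_comp
  let W : ℕ → ℕ := fun n => Encodable.encode ((List.range n).map fun i => (ε i).toNat)
  have hWdec : ∀ n, decB (W n) = initialWord ε n := fun n => by
    simp only [decB, dec, W, Denumerable.ofNat_encode, initialWord, List.map_map]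
    congr 1
    funext i
    cases h : ε i <;> simp [h]
  have hpairc {f g : ℕ → ℕ} (hf : Computable f) (hg : Computable g) :
      Computable fun n => Nat.pair (f n) (g n) := Primrec₂.natPair.to_comp.comp hf hg
  have h1 : Computable fun n : ℕ => n.unpair.1 := Computable.fst.comp .unpair
  have h2 : Computable fun n : ℕ => n.unpair.2 := Computable.snd.comp .unpair
  have happ : Computable fun n : ℕ => Encodable.encode (dec n.unpair.1 ++ [n.unpair.2]) :=
    Computable.encode.comp (Computable.list_concat.comp (hdec.comp h1) h2)
  have hW : Nat.RecursiveIn O (W : ℕ →. ℕ) := by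
    have hstep := happ.nat_recursiveIn.comp_total
      (h2.nat_recursiveIn.pair_total (horacle.comp_total h1.nat_recursiveIn))
    refine hstep.rec_total (W 0) rfl fun n => ?_
    simp [W, dec, List.range_succ]
  -- Success is coded by 0, the value that the search looks for.
  have htest : Computable fun n : ℕ =>
      bif decide (T (decB n.unpair.1) (dec n.unpair.2.unpair.1) n.unpair.2.unpair.2)
        then 0 else 1 := by
    have : ComputablePred fun n : ℕ =>
        T (decB n.unpair.1) (dec n.unpair.2.unpair.1) n.unpair.2.unpair.2 :=
      hT.comp ((hdecB.comp h1).pair ((hdec.comp (h1.comp h2)).pair (h2.comp h2)))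
    exact Computable.cond this.decide (Computable.const 0) (Computable.const 1)
  have hsearch := htest.nat_recursiveIn.comp_total ((hW.comp_total (h1.comp h2).nat_recursiveIn
    (O := O)).pair_total (hpairc h1 (h2.comp h2)).nat_recursiveIn)
  have hbif : ∀ p : Prop, (bif decide p then 0 else 1) = 0 ↔ p := fun p => by
    by_cases h : p <;> simp [h]
  let P : ℕ → ℕ → Prop := fun s n => (fun n : ℕ => bif decide (T (decB n.unpair.1)
      (dec n.unpair.2.unpair.1) n.unpair.2.unpair.2) then 0 else 1)
      (Nat.pair (W (Nat.pair s n).unpair.2.unpair.1)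
        (Nat.pair (Nat.pair s n).unpair.1 (Nat.pair s n).unpair.2.unpair.2)) = 0
  have hP : ∀ s n, P s n ↔ T (initialWord ε n.unpair.1) (dec s) n.unpair.2 := fun s n => by
    simp [P, hWdec, hbif]
  have hex' : ∀ s, ∃ n, P s n := fun s => by
    obtain ⟨n, y, h⟩ := hex (dec s)
    -- One number codes both the length of the certifying initial word and the value sought.
    exact ⟨Nat.pair n y, (hP _ _).2 (by simpa using h)⟩
  have hfind := hsearch.find_total hex'
  set F : ℕ → ℕ := fun s => Nat.find (hex' s)
  have hFT : ∀ s, T (initialWord ε (F s).unpair.1) (dec s) (F s).unpair.2 := fun s =>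
    (hP _ _).1 (Nat.find_spec (hex' s))
  let val : ℕ → ℕ := fun s => (F s).unpair.2
  have hval : Nat.RecursiveIn O (val : ℕ →. ℕ) := h2.nat_recursiveIn.comp_total hfind
  -- The state is the code of the list of all earlier values, which turns course-of-values recursion
  -- into iteration.
  let st : ℕ → ℕ := fun n => Nat.rec (Encodable.encode ([] : List ℕ))
    (fun _ s => Encodable.encode (dec s ++ [val s])) n
  have hst : Nat.RecursiveIn O (st : ℕ →. ℕ) := by
    have hstep := happ.nat_recursiveIn.comp_total
      ((h2.nat_recursiveIn).pair_total (hval.comp_total h2.nat_recursiveIn))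
    refine hstep.rec_total (st 0) rfl fun n => ?_
    simp [st]
  have hstν : ∀ n, dec (st n) = (List.range n).map fun k => val (st k) := by
    intro n
    induction n with
    | zero => simp [st, dec]
    | succ n ih =>
      rw [List.range_succ, List.map_append, ← ih]
      change dec (Encodable.encode (dec (st n) ++ [val (st n)])) = _
      simp [dec]
  refine ⟨fun n => val (st n), ?_, fun n => ⟨(F (st n)).unpair.1, ?_⟩⟩
  · exact RecursiveIn.iff_nat.2 (hval.comp_total hst)
  · rw [← hstν]
    exact hFT (st n)

end KCHom

/-! ### Assembly of the embedding. -/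

namespace KCHom

open FirstOrder.Language

variable {L : FirstOrder.Language.{u, v}} [L.Structure ℕ]

theorem listFamily_map_range (ν : ℕ → ℕ) (n : ℕ) :
    listFamily n ((List.range n).map ν) = ν ∘ Fin.val := by
  funext i
  simp [listFamily]

/-- A map all of whose restrictions to initial segments are partial embeddings is an embedding. -/
theorem exists_embedding_of_forall_sameType [L.IsRelational] {ν : ℕ → ℕ}
    (h : ∀ n, L.SameType (Fin.val : Fin n → ℕ) (ν ∘ (Fin.val : Fin n → ℕ))) :
    ∃ φ : ℕ ↪[L] ℕ, ⇑φ = ν := by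
  have hν : L.SameType (id : ℕ → ℕ) ν := by
    refine ⟨fun i j => ?_, fun R t => ?_⟩
    · exact (h (max i j + 1)).1 ⟨i, by omega⟩ ⟨j, by omega⟩
    · have ht : ∀ i, t i < (Finset.univ.sup t) + 1 := fun i =>
        Nat.lt_succ_of_le (Finset.le_sup (f := t) (Finset.mem_univ i))
      exact (h (Finset.univ.sup t + 1)).2 R fun i => ⟨t i, ht i⟩
  obtain ⟨φ, hφ⟩ := hν.exists_embedding Function.surjective_id
  exact ⟨φ, funext hφ⟩

end KCHom

theorem theorem2 (L : FirstOrder.Language.{u, v}) [L.IsRelational]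
    [Finite (Σ n : ℕ, L.Relations n)] [IsEmpty (L.Relations 0)]
    [L.Structure ℕ]
    (hrec : KCHom.IsRecursiveStructure L)
    (hhom : L.IsUltrahomogeneous ℕ)
    (hdense : KCHom.HasDenseAge L ℕ)
    (β : Bundled.{0} L.Structure) (hβ : β ∈ L.age ℕ) (hne : Nonempty β)
    (b : ℕ ≃ KCHom.copies L β) (hb : KCHom.IsRecursiveEnumeration b)
    (U : List Bool →. List Bool) (hU : KCHom.IsUniversalPrefixAlgorithm U)
    (ε : ℕ → Bool) (hε : KCHom.IsKCString U ε) :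
    ∃ ν : ℕ ↪[L] ℕ,
      (∀ c : KCHom.copies L β,
        ((c : Finset ℕ) : Set ℕ) ⊆ Set.range ν → KCHom.colouring b ε c = true) ∧
      KCHom.RecursiveRelativeTo ε ν := by
  classical
  obtain ⟨f₀, hf₀⟩ := (b 0).2
  have : Finite β := by
    have : (Set.range f₀).Finite := hf₀ ▸ Finset.finite_toSet _
    exact Set.finite_range_iff f₀.injective |>.1 this
  obtain ⟨l, hlc, hl⟩ := hb
  obtain ⟨t₀, ht₀⟩ := KCHom.exists_list_mem_copies_iff (L := L) β f₀
  have hgood := KCHom.computablePred_isGoodExtension hrec hlc t₀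
  let Partial : List ℕ → Prop := fun σ =>
    L.SameType (KCHom.listFamily σ.length (List.range σ.length)) (KCHom.listFamily σ.length σ)
  have hPartial : ∀ σ n, σ.length = n → (Partial σ ↔
      L.SameType (KCHom.listFamily n (List.range n)) (KCHom.listFamily n σ)) := by
    rintro σ _ rfl
    rfl
  have hpart : ComputablePred Partial := by
    have hn : Primrec fun σ : List ℕ => (σ.length, List.range σ.length, σ) :=
      Primrec.list_length.pair ((Primrec.list_range.comp Primrec.list_length).pair Primrec.id)
    exact (KCHom.computablePred_sameType hrec).comp hn.to_comp
  -- Making the condition vacuous on lists that are not partial embeddings keeps the search total.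
  have hstep : ∀ σ, ∃ n y, Partial σ →
      KCHom.IsGoodExtension L l t₀ (KCHom.initialWord ε n) σ y := by
    intro σ
    by_cases hσ : Partial σ
    · obtain ⟨n, y, h⟩ := KCHom.exists_of_isKCString hU hε
        (G := fun w y => KCHom.IsGoodExtension L l t₀ w σ y)
        (hgood.comp (Computable.fst.pair ((Computable.const σ).pair Computable.snd)))
        (KCHom.infinite_sameType_append hhom hdense hσ)
        (KCHom.newIndices b σ.toFinset) (fun y _ => KCHom.card_newIndices_le b _ y)
        (fun y hy z _ hyz => KCHom.disjoint_newIndices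
          (fun h => KCHom.notMem_of_sameType_append hy (List.mem_toFinset.1 h)) hyz)
        (fun w y => KCHom.isGoodExtension_iff hl ht₀)
      exact ⟨n, y, fun _ => h⟩
    · exact ⟨0, 0, fun h => absurd h hσ⟩
  obtain ⟨ν, hν, hνT⟩ := KCHom.exists_recursiveRelativeTo ε
    (T := fun w σ y => Partial σ → KCHom.IsGoodExtension L l t₀ w σ y)
    ((hpart.comp (Computable.fst.comp Computable.snd)).imp hgood) hstep
  have hνpart : ∀ n, Partial ((List.range n).map ν) := by
    intro n
    induction n with
    | zero => exact (hPartial _ 0 rfl).2 ⟨fun i => i.elim0, fun R t => Iff.rfl⟩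
    | succ n ih =>
      obtain ⟨s, hs⟩ := hνT n
      have := (hPartial _ _ (by simp)).2 (hs ih).1
      rwa [List.range_succ, List.map_append]
  obtain ⟨φ, hφ⟩ := KCHom.exists_embedding_of_forall_sameType (L := L) (ν := ν) fun n => by
    have := (hPartial _ n (by simp)).1 (hνpart n)
    rwa [KCHom.listFamily_range, KCHom.listFamily_map_range] at this
  refine ⟨φ, fun c hc => ?_, by rwa [hφ]⟩
  rw [hφ] at hc
  have hνinj : Function.Injective ν := hφ ▸ φ.injective
  have hcne : (c : Finset ℕ).Nonempty := by
    obtain ⟨f, hf⟩ := c.2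
    obtain ⟨x⟩ := hne
    exact ⟨f x, Finset.mem_coe.1 (hf ▸ Set.mem_range_self x)⟩
  let I : Finset ℕ := (c : Finset ℕ).preimage ν hνinj.injOn
  have hI : I.Nonempty := by
    obtain ⟨x, hx⟩ := hcne
    obtain ⟨i, rfl⟩ := hc hx
    exact ⟨i, Finset.mem_preimage.2 hx⟩
  -- Stage `n` adds the last point of `c`, so `c` is among the copies certified at that stage.
  obtain ⟨n, hnI, hmax⟩ := I.exists_max_image id hI
  obtain ⟨τ, hlen, hτ, hτc⟩ := (ht₀ c).1 c.2
  have hmem : ∀ x, x ∈ τ ↔ x ∈ (c : Finset ℕ) := fun x => by rw [← hτc, List.mem_toFinset]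
  obtain ⟨s, hs⟩ := hνT n
  obtain ⟨i, -, hi, hli⟩ := (hs (hνpart n)).2 τ (KCHom.mem_tuples.2 ⟨hlen, fun x hx => by
    obtain ⟨j, rfl⟩ := hc ((hmem x).1 hx)
    have hj : j ≤ n := hmax j (Finset.mem_preimage.2 ((hmem _).1 hx))
    rcases hj.lt_or_eq with hj | rfl
    · exact List.mem_append_left _ (List.mem_map.2 ⟨j, List.mem_range.2 hj, rfl⟩)
    · exact List.mem_append_right _ (List.mem_singleton.2 rfl)⟩)
    ((hmem _).2 (Finset.mem_preimage.1 hnI)) hτ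
  have hbi : b i = c := by
    apply Subtype.ext
    rw [← hl i, ← hτc]
    ext x
    rw [List.mem_toFinset, List.mem_toFinset]
    exact ⟨hli.1 x, hli.2 x⟩
  rw [KCHom.colouring, ← hbi, Equiv.symm_apply_apply]
  rw [KCHom.getElem?_initialWord] at hi
  split_ifs at hi
  exact Option.some.inj hi
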